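/- **Optimality of a stationary Markovian policy for Wasserstein distributionally robust MDPs of type $\infty$.** Let $\mathbb S,\mathbb A$ be finite sets of states and actions with $\mathbb A\neq\emptyset$, let $c\in\mathbb R^{\mathbb S\times\mathbb A}$ be a cost and $\lambda\in[0,1)$ a discount factor. Write $\Delta(X)$ for the simplex of probability vectors on a finite set $X$, and let $\mathcal U=\Delta(\mathbb S)^{\mathbb A}$. Let $d$ be a metric on $\mathcal U$ inducing its usual topology (for example $\ell_1$, $\ell_2$ or $\ell_\infty$). For Borel probability measures $\mu,\nu$ on $\mathcal U$ let $$W_\infty(\mu,\nu)=\inf\{\kappa\text{-}\operatorname{ess\,sup} d \;:\; \kappa \text{ a coupling of } \mu \text{ and } \nu\}.$$ Let $N\ge 1$, $\theta\ge 0$, and for each state $s$ let $\hat y_{1,s},\dots,\hat y_{N,s}\in\mathcal U$ and $\nu_s=\frac1N\sum_{i=1}^N\delta_{\hat y_{i,s}}$. Consider the ambiguity sets $$\mathbb D_s=\{\mu_s\in P(\mathcal U): W_\infty(\mu_s,\nu_s)\le\theta\},\qquad \mathbb D=\Big\{\bigotimes_{s}\mu_s : \mu_s\in\mathbb D_s \text{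 for all } s\in\mathbb S\Big\}.$$ A policy $\pi$ is randomized and may depend on the history: at each time $t$ it gives a distribution over actions depending on $s_0,a_0,\dots,s_{t-1},a_{t-1},s_t$. The stationary Markovian policies are the $x\in\Pi=\Delta(\mathbb A)^{\mathbb S}$. Given an initial distribution $p_0\in\Delta(\mathbb S)$, a policy $\pi$ and $\mu\in\mathbb D$, let $s_0\sim p_0$, and at each time $t$ let $a_t$ be drawn from the policy and, independently of the past and of $a_t$, let a transition kernel $y_t=(y_{t,sa})_{s,a}\sim\mu$ be drawn; then $s_{t+1}\sim y_{t,s_ta_t}$. Put $$C_{p_0}(\pi,\mu)=\mathbb E\Big[\sum_{t=0}^\infty\lambda^t c_{s_ta_t}\Big],\qquad v_s=\inf_{x\in\Pi}\,\sup_{\mu\in\mathbb D}C_{\delta_s}(x,\mu),$$ and, for $s\in\mathbb S$ and $x\in\mathbb R^{\mathbb A}$, $$g_s(x)=\sup_{\mu_s\in\mathbb D_s}\ \mathbb E_{y\sim\mu_s}\Big[\sum_{a}x_a\big(c_{sa}+\lambda\, y_a^\top v\big)\Big].$$ Then: 1. for every $s$, the supremum defining $g_s(x)$ is attained for each $x\in\mathbb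 R^{\mathbb A}$, and $g_s:\mathbb R^{\mathbb A}\to\mathbb R$ is a closed (i.e. lower semicontinuous) proper convex function; 2. $v$ satisfies the Bellman equation $v_s=\min_{x\in\Delta(\mathbb A)}g_s(x)$ for every $s$, the minimum being attained; 3. there is $x^*\in\Pi$ such that, for every $s$, $x^*_s$ minimizes $g_s$ over $\Delta(\mathbb A)$; and every such stationary Markovian policy $x^*$ is optimal: for every $p_0\in\Delta(\mathbb S)$ the maximum $\max_{\mu\in\mathbb D}C_{p_0}(x^*,\mu)$ is attained, and $$\max_{\mu\in\mathbb D}C_{p_0}(x^*,\mu)\le\sup_{\mu\in\mathbb D}C_{p_0}(\pi,\mu)\quad\text{for every (history-dependent, randomized) policy }\pi.$$ -/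

import Mathlib

open MeasureTheory ProbabilityTheory
open scoped ENNReal

namespace DRMDP

/-- The set `𝒰 = Δ(S)^A` of the transition parameters of one state: each action is given a
probability vector on the set `S` of states. It carries the product (that is, Borel)
σ-algebra. -/
abbrev StateKernel (S A : Type*) [Fintype S] := A → stdSimplex ℝ S

/-- A full transition kernel `(y_{sa})_{s,a}`. -/
abbrev TransKernel (S A : Type*) [Fintype S] := S → StateKernel S A

/-! ### Type-∞ Wasserstein ambiguity sets -/

/-- `d` is a metric on `𝒰` that is continuous for the usual topology of `𝒰`. As `𝒰` is compact,
this says that `d` is a metric inducing the usual topology. Every metric that comes from a norm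
on `ℝ^{A × S}` is of this kind, for instance `ℓ₁`, `ℓ₂` and `ℓ_∞`. -/
structure IsKernelMetric {S A : Type*} [Fintype S]
    (d : StateKernel S A → StateKernel S A → ℝ) : Prop where
  eq_zero_iff : ∀ x y, d x y = 0 ↔ x = y
  symm : ∀ x y, d x y = d y x
  triangle : ∀ x y z, d x z ≤ d x y + d y z
  continuous : Continuous fun z : StateKernel S A × StateKernel S A => d z.1 z.2

/-- The type-∞ Wasserstein distance `W_∞(μ, ν)`: the least `κ`-essential supremum of `d` over all
couplings `κ` of `μ` and `ν`. -/
noncomputable def wassersteinInfty {S A : Type*} [Fintype S]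
    (d : StateKernel S A → StateKernel S A → ℝ) (μ ν : Measure (StateKernel S A)) : ℝ≥0∞ :=
  ⨅ κ ∈ {κ : ProbabilityMeasure (StateKernel S A × StateKernel S A) |
      (κ : Measure (StateKernel S A × StateKernel S A)).map Prod.fst = μ ∧
      (κ : Measure (StateKernel S A × StateKernel S A)).map Prod.snd = ν},
    essSup (fun z => ENNReal.ofReal (d z.1 z.2))
      (κ : Measure (StateKernel S A × StateKernel S A))

/-- The nominal distribution `(1/N) ∑ i, δ_{ŷ i}`. -/
noncomputable def empiricalMeasure {S A : Type*} [Fintype S] {N : ℕ}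
    (yhat : Fin N → StateKernel S A) : Measure (StateKernel S A) :=
  (N : ℝ≥0∞)⁻¹ • ∑ i, Measure.dirac (yhat i)

/-- The ambiguity set `𝔻_s` of one state: the ball of radius `θ` for `W_∞` around the nominal
distribution. -/
def stateAmbiguity {S A : Type*} [Fintype S] (d : StateKernel S A → StateKernel S A → ℝ) {N : ℕ}
    (yhat : Fin N → StateKernel S A) (θ : ℝ) : Set (ProbabilityMeasure (StateKernel S A)) :=
  {μ | wassersteinInfty d (μ : Measure (StateKernel S A)) (empiricalMeasure yhat)
    ≤ ENNReal.ofReal θ}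

/-- The `s`-rectangular ambiguity set `{⨂ μ_s | μ_s ∈ 𝔻_s for all s}` defined by the sets `𝔻_s`. -/
noncomputable def rectangular {S A : Type*} [Fintype S]
    (D : S → Set (ProbabilityMeasure (StateKernel S A))) :
    Set (ProbabilityMeasure (TransKernel S A)) :=
  {μ | ∃ m : S → ProbabilityMeasure (StateKernel S A),
    (∀ s, m s ∈ D s) ∧ μ = ProbabilityMeasure.pi m}

/-! ### Policies and the controlled process -/

/-- A randomized, history-dependent policy: at time `t`, given the past states and actions
`s_0, a_0, …, s_{t-1}, a_{t-1}` and the present state `s_t`, it returns a distribution over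
actions. -/
abbrev Policy (S A : Type*) [Fintype A] := (t : ℕ) → (Fin t → S × A) → S → stdSimplex ℝ A

/-- The stationary Markovian policy given by `x ∈ Π = Δ(A)^S`. -/
def stationary {S A : Type*} [Fintype A] (x : S → stdSimplex ℝ A) : Policy S A :=
  fun _ _ s => x s

/-- What happens at one time `t`: the state `s_t`, the action `a_t`, and the transition kernel
`y_t` that is realized at that time. -/
abbrev Stage (S A : Type*) [Fintype S] := S × A × TransKernel S A

/-- The law of a stage `(s, a, y)` with `s ∼ q`, `a ∼ f s`, and `y ∼ μ` independent of
`(s, a)`. -/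
noncomputable def stageLaw {S A : Type*} [Fintype S] [Fintype A] [MeasurableSpace S]
    [MeasurableSpace A] (q : stdSimplex ℝ S) (f : S → stdSimplex ℝ A)
    (μ : ProbabilityMeasure (TransKernel S A)) : Measure (Stage S A) :=
  ∑ s : S, ∑ a : A, ENNReal.ofReal (q s * f s a) •
    (Measure.dirac s).prod ((Measure.dirac a).prod (μ : Measure (TransKernel S A)))

theorem isProbabilityMeasure_stageLaw {S A : Type*} [Fintype S] [Fintype A] [MeasurableSpace S]
    [MeasurableSpace A] (q : stdSimplex ℝ S) (f : S → stdSimplex ℝ A)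
    (μ : ProbabilityMeasure (TransKernel S A)) : IsProbabilityMeasure (stageLaw q f μ) := by
  have hq : ∀ s, 0 ≤ q s := q.2.1
  have hf : ∀ s a, 0 ≤ f s a := fun s => (f s).2.1
  constructor
  simp only [stageLaw, Measure.coe_finsetSum, Finset.sum_apply, Measure.smul_apply, measure_univ,
    smul_eq_mul, mul_one]
  simp_rw [← ENNReal.ofReal_sum_of_nonneg (fun a _ => mul_nonneg (hq _) (hf _ a)),
    ← Finset.mul_sum]
  have h1 : ∀ s, ∑ a, f s a = 1 := fun s => (f s).2.2
  have h2 : ∑ s, q s = 1 := q.2.2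
  simp only [h1, mul_one]
  rw [← ENNReal.ofReal_sum_of_nonneg (fun s _ => hq s), h2, ENNReal.ofReal_one]

/-- The law of stage `n + 1` given the stages `0, …, n`: the new state is drawn from the row
`y_n(s_n, a_n)` of the kernel realized at time `n`, the action from the policy, and a new
kernel from `μ`. -/
noncomputable def stepKernel {S A : Type*} [Fintype S] [Fintype A] [MeasurableSpace S]
    [DiscreteMeasurableSpace S] [MeasurableSpace A] [DiscreteMeasurableSpace A]
    (π : Policy S A) (μ : ProbabilityMeasure (TransKernel S A)) (n : ℕ) :
    Kernel ((i : Finset.Iic n) → (fun _ : ℕ => Stage S A) i) ((fun _ : ℕ => Stage S A) (n + 1)) where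
  toFun h :=
    let last := h ⟨n, Finset.mem_Iic.2 le_rfl⟩
    let past : Fin (n + 1) → S × A := fun i =>
      let z := h ⟨i, Finset.mem_Iic.2 (Nat.lt_succ_iff.1 i.2)⟩
      (z.1, z.2.1)
    stageLaw (last.2.2 last.1 last.2.1) (π (n + 1) past) μ
  measurable' := by
    refine Measure.measurable_of_measurable_coe _ fun B hB => ?_
    simp only [stageLaw, Measure.coe_finsetSum, Finset.sum_apply, Measure.smul_apply, smul_eq_mul]
    refine Finset.measurable_sum _ fun s _ => Finset.measurable_sum _ fun a _ => ?_
    refine Measurable.mul_const (Measurable.ennreal_ofReal (Measurable.mul ?_ ?_)) _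
    · have h1 : Measurable fun z : S × A × TransKernel S A => z.2.2 z.1 z.2.1 s := by
        refine measurable_from_prod_countable_right fun s' => ?_
        refine measurable_from_prod_countable_right fun a' => ?_
        have h2 : Measurable fun y : TransKernel S A => y s' a' := by fun_prop
        exact (measurable_pi_apply s).comp (measurable_subtype_coe.comp h2)
      exact h1.comp (measurable_pi_apply _)
    · have h1 : Measurable fun p : Fin (n + 1) → S × A => π (n + 1) p s a :=
        measurable_of_finite _
      refine h1.comp (measurable_pi_lambda _ fun i => ?_)
      have h2 : Measurable fun z : S × A × TransKernel S A => (z.1, z.2.1) := by fun_prop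
      exact h2.comp (measurable_pi_apply _)

instance {S A : Type*} [Fintype S] [Fintype A] [MeasurableSpace S]
    [DiscreteMeasurableSpace S] [MeasurableSpace A] [DiscreteMeasurableSpace A]
    (π : Policy S A) (μ : ProbabilityMeasure (TransKernel S A)) (n : ℕ) :
    IsMarkovKernel (stepKernel π μ n) :=
  ⟨fun _ => isProbabilityMeasure_stageLaw _ _ _⟩

/-- The law of the whole process `(s_t, a_t, y_t)_{t ∈ ℕ}` with `s_0 ∼ p₀`, under the policy `π` and
the distribution `μ` of the transition kernels. -/
noncomputable def trajLaw {S A : Type*} [Fintype S] [Fintype A] [MeasurableSpace S]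
    [DiscreteMeasurableSpace S] [MeasurableSpace A] [DiscreteMeasurableSpace A]
    (p₀ : stdSimplex ℝ S) (π : Policy S A) (μ : ProbabilityMeasure (TransKernel S A)) :
    Measure (ℕ → Stage S A) :=
  ((stageLaw p₀ (π 0 Fin.elim0) μ).map
      fun z => (fun _ => z : (i : Finset.Iic 0) → (fun _ : ℕ => Stage S A) i)).bind
    (Kernel.traj (X := fun _ : ℕ => Stage S A) (stepKernel π μ) 0)

/-- The expected discounted cost `C(π, μ) = 𝔼 [∑ t, γ ^ t * c (s_t) (a_t) | s_0 ∼ p₀]`, with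
discount factor `γ`. -/
noncomputable def discountedCost {S A : Type*} [Fintype S] [Fintype A] [MeasurableSpace S]
    [DiscreteMeasurableSpace S] [MeasurableSpace A] [DiscreteMeasurableSpace A]
    (c : S → A → ℝ) (γ : ℝ) (p₀ : stdSimplex ℝ S) (π : Policy S A)
    (μ : ProbabilityMeasure (TransKernel S A)) : ℝ :=
  ∫ ω, ∑' t : ℕ, γ ^ t * c (ω t).1 (ω t).2.1 ∂(trajLaw p₀ π μ)

/-- The worst-case cost of a policy over the ambiguity set `D`. The costs are bounded, so for a
non-empty `D` this is a genuine supremum. -/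
noncomputable def worstCaseCost {S A : Type*} [Fintype S] [Fintype A] [MeasurableSpace S]
    [DiscreteMeasurableSpace S] [MeasurableSpace A] [DiscreteMeasurableSpace A]
    (c : S → A → ℝ) (γ : ℝ) (D : Set (ProbabilityMeasure (TransKernel S A)))
    (p₀ : stdSimplex ℝ S) (π : Policy S A) : ℝ :=
  sSup (discountedCost c γ p₀ π '' D)

/-- The value vector: `v s` is the optimal worst-case cost, over the stationary Markovian policies
`x ∈ Π`, from the initial state `s`. -/
noncomputable def valueVector {S A : Type*} [Fintype S] [DecidableEq S] [Fintype A]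
    [MeasurableSpace S] [DiscreteMeasurableSpace S] [MeasurableSpace A] [DiscreteMeasurableSpace A]
    (c : S → A → ℝ) (γ : ℝ) (D : Set (ProbabilityMeasure (TransKernel S A))) : S → ℝ :=
  fun s => ⨅ x : S → stdSimplex ℝ A,
    worstCaseCost c γ D (stdSimplex.vertex s) (stationary x)

/-! ### The Bellman equation -/

/-- `𝔼_{y ∼ μ} [∑ a, x_a (c_{sa} + γ y_aᵀ v)]` for one state, where `cs = (c_{sa})_a`. -/
noncomputable def bellmanCost {S A : Type*} [Fintype S] [Fintype A] (cs : A → ℝ) (γ : ℝ)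
    (v : S → ℝ) (x : A → ℝ) (μ : ProbabilityMeasure (StateKernel S A)) : ℝ :=
  ∫ y, ∑ a, x a * (cs a + γ * ∑ s', y a s' * v s') ∂(μ : Measure (StateKernel S A))

/-- The function of `x` that is minimized over the simplex in the Bellman equation: the worst case
of `bellmanCost` over the ambiguity set of the state. -/
noncomputable def bellmanObjective {S A : Type*} [Fintype S] [Fintype A] (cs : A → ℝ) (γ : ℝ)
    (D : Set (ProbabilityMeasure (StateKernel S A))) (v : S → ℝ) (x : A → ℝ) : ℝ :=
  sSup (bellmanCost cs γ v x '' D)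

end DRMDP

namespace DRMDP

open Filter Topology

set_option linter.unusedSectionVars false

/-! ### Type-∞ Wasserstein balls around a finitely supported law -/

section Ambiguity

variable {S A : Type*} [Fintype S] {d : StateKernel S A → StateKernel S A → ℝ} {N : ℕ}
  {yhat : Fin N → StateKernel S A} {θ : ℝ}

/-! Only two properties of a state's ambiguity set matter (`IsAdversary`): continuous functions
attain a largest expectation on it, and it is stable under mixtures. For the first, move every atom
of the nominal law to a maximizer in its closed `θ`-ball. No other law does better: membership gives
couplings with `d ≤ θ + ε` for every `ε > 0`, and by compactness the maximum over the enlarged ball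
tends to the maximum over the ball.

The realized kernel is independent of the history and the current action. Expected costs therefore
depend only on the state-action occupancies and the mean kernel, and a one-step inequality for a
vector `w` telescopes to a bound on the discounted cost by `∑ s, p₀ s * w s`.

Let `w` be the fixed point of the robust Bellman operator, a `γ`-contraction. Minimizers `x` have
worst-case cost exactly `∑ s, p₀ s * w s`, attained by the product of their worst laws. Conversely,
a minimax argument in each state (`IsAdversary.exists_forall_sub_le_meanCost`) gives one law against
which every action costs at least `w s - ε`. As this holds action by action, the product of these
laws bounds all history-dependent policies from below. Hence `v = w`, and `x` is optimal among all
policies. -/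

theorem mem_stateAmbiguity_iff (hθ : 0 ≤ θ) (m : ProbabilityMeasure (StateKernel S A)) :
    m ∈ stateAmbiguity d yhat θ ↔ ∀ ε : ℝ, 0 < ε →
      ∃ κ : ProbabilityMeasure (StateKernel S A × StateKernel S A),
        (κ : Measure (StateKernel S A × StateKernel S A)).map Prod.fst = m ∧
        (κ : Measure (StateKernel S A × StateKernel S A)).map Prod.snd = empiricalMeasure yhat ∧
        ∀ᵐ z ∂(κ : Measure (StateKernel S A × StateKernel S A)), d z.1 z.2 ≤ θ + ε := by
  constructor
  · intro hm ε hε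
    have h1 : wassersteinInfty d (m : Measure (StateKernel S A)) (empiricalMeasure yhat)
        < ENNReal.ofReal (θ + ε) :=
      lt_of_le_of_lt hm ((ENNReal.ofReal_lt_ofReal_iff (by linarith)).2 (by linarith))
    simp only [wassersteinInfty, iInf_lt_iff] at h1
    obtain ⟨κ, ⟨hκ1, hκ2⟩, hκ3⟩ := h1
    refine ⟨κ, hκ1, hκ2, ?_⟩
    filter_upwards [ae_lt_of_essSup_lt hκ3] with z hz
    exact ((ENNReal.ofReal_lt_ofReal_iff (by linarith)).1 hz).le
  · intro h
    refine ENNReal.le_of_forall_pos_le_add fun ε hε _ => ?_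
    obtain ⟨κ, hκ1, hκ2, hκ3⟩ := h ε hε
    refine (iInf₂_le κ ⟨hκ1, hκ2⟩).trans (essSup_le_of_ae_le _ ?_)
    filter_upwards [hκ3] with z hz
    refine (ENNReal.ofReal_le_ofReal hz).trans ?_
    rw [ENNReal.ofReal_add hθ (NNReal.coe_nonneg ε), ENNReal.ofReal_coe_nnreal]

/-- The set `stateAmbiguity d yhat θ` is closed under mixtures. -/
theorem exists_mem_stateAmbiguity_mix (hθ : 0 ≤ θ) {m₁ m₂ : ProbabilityMeasure (StateKernel S A)}
    (h₁ : m₁ ∈ stateAmbiguity d yhat θ) (h₂ : m₂ ∈ stateAmbiguity d yhat θ) {a b : ℝ≥0∞}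
    (hab : a + b = 1) :
    ∃ m ∈ stateAmbiguity d yhat θ, (m : Measure (StateKernel S A)) =
      a • (m₁ : Measure (StateKernel S A)) + b • (m₂ : Measure (StateKernel S A)) := by
  refine ⟨⟨a • (m₁ : Measure (StateKernel S A)) + b • (m₂ : Measure (StateKernel S A)),
    ⟨by simp [hab]⟩⟩, (mem_stateAmbiguity_iff hθ _).2 ?_, rfl⟩
  rw [mem_stateAmbiguity_iff hθ] at h₁ h₂
  intro ε hε
  obtain ⟨κ₁, hf₁, hs₁, hd₁⟩ := h₁ ε hε
  obtain ⟨κ₂, hf₂, hs₂, hd₂⟩ := h₂ ε hε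
  -- Mix the couplings with the same weights. Both have the nominal law as second marginal, so the
  -- mixture has it too.
  refine ⟨⟨a • (κ₁ : Measure (StateKernel S A × StateKernel S A)) +
    b • (κ₂ : Measure (StateKernel S A × StateKernel S A)), ⟨by simp [hab]⟩⟩, ?_, ?_, ?_⟩
  · simp only [ProbabilityMeasure.coe_mk]
    rw [Measure.map_add _ _ measurable_fst, Measure.map_smul, Measure.map_smul, hf₁, hf₂]
  · simp only [ProbabilityMeasure.coe_mk]
    rw [Measure.map_add _ _ measurable_snd, Measure.map_smul, Measure.map_smul, hs₁, hs₂,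
      ← add_smul, hab, one_smul]
  · simp only [ProbabilityMeasure.coe_mk]
    rw [ae_add_measure_iff]
    exact ⟨Measure.ae_smul_measure hd₁ a, Measure.ae_smul_measure hd₂ b⟩

theorem isProbabilityMeasure_smul_sum_dirac {X : Type*} [MeasurableSpace X] (hN : 0 < N)
    (y : Fin N → X) : IsProbabilityMeasure ((N : ℝ≥0∞)⁻¹ • ∑ i, Measure.dirac (y i)) := by
  constructor
  simp only [Measure.smul_apply, Measure.coe_finsetSum, Finset.sum_apply, measure_univ,
    Finset.sum_const, Finset.card_univ, Fintype.card_fin, nsmul_eq_mul, mul_one, smul_eq_mul]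
  exact ENNReal.inv_mul_cancel (by exact_mod_cast hN.ne') (ENNReal.natCast_ne_top N)

variable [Fintype A]

/-- The uniform coupling on the pairs `(y i, yhat i)` moves no mass farther than `θ`. -/
theorem exists_eq_empiricalMeasure_mem_stateAmbiguity (hθ : 0 ≤ θ) (hN : 0 < N)
    {y : Fin N → StateKernel S A} (hy : ∀ i, d (y i) (yhat i) ≤ θ) :
    ∃ m ∈ stateAmbiguity d yhat θ, (m : Measure (StateKernel S A)) = empiricalMeasure y := by
  refine ⟨⟨empiricalMeasure y, isProbabilityMeasure_smul_sum_dirac hN y⟩,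
    (mem_stateAmbiguity_iff hθ _).2 ?_, rfl⟩
  intro ε hε
  refine ⟨⟨_, isProbabilityMeasure_smul_sum_dirac hN fun i => (y i, yhat i)⟩, ?_, ?_, ?_⟩
  · simp only [ProbabilityMeasure.coe_mk, empiricalMeasure, Measure.map_smul]
    rw [Measure.map_finset_sum measurable_fst.aemeasurable]
    simp only [Measure.map_dirac' measurable_fst]
  · simp only [ProbabilityMeasure.coe_mk, empiricalMeasure, Measure.map_smul]
    rw [Measure.map_finset_sum measurable_snd.aemeasurable]
    simp only [Measure.map_dirac' measurable_snd]
  · simp only [ProbabilityMeasure.coe_mk]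
    refine Measure.ae_smul_measure ?_ _
    rw [ae_finsetSum_measure_iff]
    intro i _
    rw [ae_dirac_eq]
    exact (hy i).trans (by linarith)

/-- The maximum of `f` over a sublevel set `{h ≤ θ}` is upper semicontinuous in `θ`. -/
theorem eventually_forall_le_add {X : Type*} [TopologicalSpace X] [CompactSpace X] {f h : X → ℝ}
    (hf : Continuous f) (hh : Continuous h) {M η : ℝ} (hη : 0 < η)
    (hM : ∀ y, h y ≤ θ → f y ≤ M) :
    ∀ᶠ ε in 𝓝[>] (0 : ℝ), ∀ y, h y ≤ θ + ε → f y ≤ M + η := by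
  have hc : IsCompact {y | M + η ≤ f y} := (isClosed_le continuous_const hf).isCompact
  rcases Set.eq_empty_or_nonempty {y | M + η ≤ f y} with he | hne
  · refine Eventually.of_forall fun ε y _ => ?_
    by_contra hlt
    exact (he ▸ (show y ∈ {y | M + η ≤ f y} from (not_le.1 hlt).le) : y ∈ (∅ : Set X))
  -- On the compact set `{M + η ≤ f}` the minimum of `h` exceeds `θ`; any `ε` below this gap works.
  · obtain ⟨y₀, hy₀, hmin⟩ := hc.exists_isMinOn hne hh.continuousOn
    have hlt : θ < h y₀ := by
      by_contra hle
      have h1 := hM y₀ (not_lt.1 hle)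
      have h2 : M + η ≤ f y₀ := hy₀
      linarith
    have hev : ∀ᶠ ε in 𝓝[>] (0 : ℝ), ε < h y₀ - θ :=
      nhdsWithin_le_nhds (Iio_mem_nhds (by linarith))
    filter_upwards [hev] with ε hε y hy
    by_contra hcon
    have h3 : h y₀ ≤ h y := hmin (show M + η ≤ f y from (not_le.1 hcon).le)
    linarith

theorem integrable_of_continuous {X : Type*} [TopologicalSpace X] [CompactSpace X]
    [MeasurableSpace X] [OpensMeasurableSpace X] {f : X → ℝ} (hf : Continuous f) (m : Measure X)
    [IsFiniteMeasure m] : Integrable f m := by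
  obtain ⟨C, hC⟩ := isCompact_univ.exists_bound_of_continuousOn hf.continuousOn
  exact Integrable.of_bound hf.measurable.aestronglyMeasurable C
    (Eventually.of_forall fun x => hC x trivial)

/-- No measurability of `f` is needed against finitely many atoms, so pointwise maximizers can be
chosen without a measurable selection. -/
theorem integrable_empiricalMeasure (hN : 0 < N) (f : StateKernel S A → ℝ)
    (y : Fin N → StateKernel S A) : Integrable f (empiricalMeasure y) := by
  refine Integrable.smul_measure ?_ (by simp [hN.ne'])
  rw [integrable_finsetSum_measure]
  exact fun i _ => integrable_dirac (by simp)

theorem integral_empiricalMeasure (f : StateKernel S A → ℝ)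
    (y : Fin N → StateKernel S A) :
    ∫ z, f z ∂(empiricalMeasure y) = (N : ℝ)⁻¹ * ∑ i, f (y i) := by
  rw [empiricalMeasure, integral_smul_measure, integral_finsetSum_measure
    fun i _ => integrable_dirac (by simp)]
  simp

theorem ae_empiricalMeasure_mem_range (y : Fin N → StateKernel S A) :
    ∀ᵐ z ∂(empiricalMeasure y), z ∈ Set.range y := by
  refine Measure.ae_smul_measure ?_ _
  rw [ae_finsetSum_measure_iff]
  intro i _
  rw [ae_dirac_eq]
  exact Set.mem_range_self i

/-- A continuous function has a largest expectation over the ambiguity set of a state. -/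
theorem exists_isMaxOn_stateAmbiguity (hd : IsKernelMetric d) (hθ : 0 ≤ θ) (hN : 0 < N)
    (yhat : Fin N → StateKernel S A) {f : StateKernel S A → ℝ} (hf : Continuous f) :
    ∃ m ∈ stateAmbiguity d yhat θ, ∀ m' ∈ stateAmbiguity d yhat θ,
      ∫ y, f y ∂(m' : Measure (StateKernel S A)) ≤ ∫ y, f y ∂(m : Measure (StateKernel S A)) := by
  have hdc : ∀ z, Continuous fun y => d y z := fun z =>
    hd.continuous.comp (continuous_id.prodMk continuous_const)
  have hY : ∀ z, ∃ y, d y z ≤ θ ∧ ∀ y', d y' z ≤ θ → f y' ≤ f y := fun z => by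
    have hc : IsCompact {y | d y z ≤ θ} := (isClosed_le (hdc z) continuous_const).isCompact
    obtain ⟨y, hy, hmax⟩ := hc.exists_isMaxOn
      ⟨z, show d z z ≤ θ by rwa [(hd.eq_zero_iff z z).2 rfl]⟩ hf.continuousOn
    exact ⟨y, hy, fun y' hy' => hmax hy'⟩
  choose Y hYd hYf using hY
  obtain ⟨m, hm, hmY⟩ := exists_eq_empiricalMeasure_mem_stateAmbiguity
    (y := fun i => Y (yhat i)) hθ hN fun i => hYd _
  refine ⟨m, hm, fun m' hm' => ?_⟩
  rw [hmY]
  refine le_of_forall_pos_le_add fun η hη => ?_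
  -- There are finitely many atoms, so one `ε` serves them all.
  have hev : ∀ᶠ ε in 𝓝[>] (0 : ℝ), ∀ i, ∀ y, d y (yhat i) ≤ θ + ε → f y ≤ f (Y (yhat i)) + η :=
    eventually_all.2 fun i => eventually_forall_le_add hf (hdc _) hη (hYf _)
  obtain ⟨ε, hε, hε0⟩ := (hev.and self_mem_nhdsWithin).exists
  obtain ⟨κ, hκ1, hκ2, hκ3⟩ := (mem_stateAmbiguity_iff hθ m').1 hm' ε hε0
  have hG := integrable_empiricalMeasure hN (fun z => f (Y z) + η) yhat
  have hG' : Integrable (fun z : StateKernel S A × StateKernel S A => f (Y z.2) + η)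
      (κ : Measure (StateKernel S A × StateKernel S A)) := by
    rw [← hκ2] at hG
    exact hG.comp_measurable measurable_snd
  calc ∫ y, f y ∂(m' : Measure (StateKernel S A))
      = ∫ z, f z.1 ∂(κ : Measure (StateKernel S A × StateKernel S A)) := by
        rw [← hκ1, integral_map measurable_fst.aemeasurable hf.measurable.aestronglyMeasurable]
    _ ≤ ∫ z, f (Y z.2) + η ∂(κ : Measure (StateKernel S A × StateKernel S A)) := by
        refine integral_mono_ae (integrable_of_continuous (hf.comp continuous_fst) _) hG' ?_
        -- The choice of `ε` controls only balls centred at atoms; almost surely the second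
        -- coordinate is one.
        have hr := ae_empiricalMeasure_mem_range yhat
        rw [← hκ2] at hr
        filter_upwards [hκ3, ae_of_ae_map measurable_snd.aemeasurable hr] with z hz hz2
        obtain ⟨i, hi⟩ := hz2
        rw [← hi] at hz ⊢
        exact hε i _ hz
    _ = ∫ z, f (Y z) + η ∂(empiricalMeasure yhat) := by
        rw [← hκ2] at hG ⊢
        rw [integral_map measurable_snd.aemeasurable hG.aestronglyMeasurable]
    _ = _ := by
        rw [integral_empiricalMeasure, integral_empiricalMeasure, Finset.sum_add_distrib, mul_add]
        simp only [Finset.sum_const, Finset.card_univ, Fintype.card_fin, nsmul_eq_mul]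
        rw [inv_mul_cancel_left₀ (by exact_mod_cast hN.ne')]

end Ambiguity

/-! ### Telescoping of discounted sums -/

theorem summable_pow_mul_of_abs_le {γ : ℝ} (hγ0 : 0 ≤ γ) (hγ1 : γ < 1) {r : ℕ → ℝ} {M : ℝ}
    (hr : ∀ n, |r n| ≤ M) : Summable fun n => γ ^ n * r n := by
  refine Summable.of_norm_bounded ((summable_geometric_of_lt_one hγ0 hγ1).mul_right M) fun n => ?_
  rw [norm_mul, norm_pow, Real.norm_eq_abs, Real.norm_eq_abs, abs_of_nonneg hγ0]
  exact mul_le_mul_of_nonneg_left (hr n) (pow_nonneg hγ0 n)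

theorem hasSum_discounted_telescope {γ : ℝ} (hγ0 : 0 ≤ γ) (hγ1 : γ < 1) {W : ℕ → ℝ} {M : ℝ}
    (hW : ∀ n, |W n| ≤ M) : HasSum (fun n => γ ^ n * (W n - γ * W (n + 1))) (W 0) := by
  obtain ⟨T, hT⟩ := summable_pow_mul_of_abs_le hγ0 hγ1 hW
  have h2 := (hasSum_nat_add_iff' 1).2 hT
  rw [Finset.sum_range_one, pow_zero, one_mul] at h2
  have h := hT.sub h2
  rw [sub_sub_cancel] at h
  refine (funext fun n => ?_ : (fun n => γ ^ n * (W n - γ * W (n + 1))) = _) ▸ h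
  ring

/-- Weighted by `γ ^ n` and summed, the one-step inequalities telescope in `W`; a slack `ε` per step
accumulates to a geometric series. -/
theorem le_of_forall_discounted_le {γ : ℝ} (hγ0 : 0 ≤ γ) (hγ1 : γ < 1) {r W : ℕ → ℝ} {M C ε : ℝ}
    (hW : ∀ n, |W n| ≤ M) (hC : HasSum (fun n => γ ^ n * r n) C)
    (h : ∀ n, W n - ε ≤ r n + γ * W (n + 1)) : W 0 - ε / (1 - γ) ≤ C := by
  have h1 := (hasSum_discounted_telescope hγ0 hγ1 hW).sub
    ((hasSum_geometric_of_lt_one hγ0 hγ1).mul_right ε)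
  rw [inv_mul_eq_div] at h1
  refine hasSum_le (fun n => ?_) h1 hC
  rw [← mul_sub]
  exact mul_le_mul_of_nonneg_left (by linarith [h n]) (pow_nonneg hγ0 n)

/-! ### Occupancies and costs of the controlled process -/

section Trajectory

variable {S A : Type*} [Fintype S] [Fintype A] [MeasurableSpace S] [DiscreteMeasurableSpace S]
  [MeasurableSpace A] [DiscreteMeasurableSpace A]
  (p₀ : stdSimplex ℝ S) (π : Policy S A) (μ : ProbabilityMeasure (TransKernel S A))

theorem trajLaw_eq_comp : trajLaw p₀ π μ =
    (Kernel.traj (X := fun _ : ℕ => Stage S A) (stepKernel π μ) 0) ∘ₘ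
    ((stageLaw p₀ (π 0 Fin.elim0) μ).map
      fun z => (fun _ => z : (i : Finset.Iic 0) → (fun _ : ℕ => Stage S A) i)) := rfl

theorem measurable_const_history : Measurable
    fun z : Stage S A => (fun _ => z : (i : Finset.Iic 0) → (fun _ : ℕ => Stage S A) i) :=
  measurable_pi_lambda _ fun _ => measurable_id

instance : IsProbabilityMeasure (trajLaw p₀ π μ) := by
  have := isProbabilityMeasure_stageLaw p₀ (π 0 Fin.elim0) μ
  have := Measure.isProbabilityMeasure_map (μ := stageLaw p₀ (π 0 Fin.elim0) μ)
    (measurable_const_history (S := S) (A := A)).aemeasurable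
  rw [trajLaw_eq_comp]
  infer_instance

theorem trajLaw_map_zero :
    (trajLaw p₀ π μ).map (fun ω => ω 0) = stageLaw p₀ (π 0 Fin.elim0) μ := by
  have hf : (fun ω : ℕ → Stage S A => ω 0) =
      (fun h : (i : Finset.Iic 0) → (fun _ : ℕ => Stage S A) i => h ⟨0, by simp⟩) ∘
        Preorder.frestrictLe 0 := rfl
  rw [hf, ← Measure.map_map (by fun_prop) (by fun_prop), trajLaw_eq_comp,
    Measure.map_comp _ _ (by fun_prop), Kernel.traj_map_frestrictLe, Kernel.partialTraj_self,
    Measure.id_comp, Measure.map_map (by fun_prop) measurable_const_history]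
  exact Measure.map_id

theorem trajLaw_map_succ (n : ℕ) :
    (trajLaw p₀ π μ).map (fun ω => ω (n + 1)) =
      (stepKernel π μ n) ∘ₘ ((trajLaw p₀ π μ).map (Preorder.frestrictLe n)) := by
  rw [trajLaw_eq_comp, Measure.map_comp _ _ (by fun_prop), Measure.map_comp _ _ (by fun_prop),
    Kernel.traj_map_frestrictLe, Measure.comp_assoc,
    ← Kernel.traj_comp_partialTraj (Nat.zero_le n), Kernel.map_comp, Kernel.map_traj_succ_self]

/-- The joint law of a state, an action and a transition kernel drawn from `μ`, when the state and
the action have weights `P s a`. -/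
noncomputable def weightedLaw (P : S → A → ℝ) : Measure (Stage S A) :=
  ∑ s : S, ∑ a : A, ENNReal.ofReal (P s a) •
    (Measure.dirac s).prod ((Measure.dirac a).prod (μ : Measure (TransKernel S A)))

theorem integral_weightedLaw {P : S → A → ℝ} (hP : ∀ s a, 0 ≤ P s a)
    {g : Stage S A → ℝ}
    (hg : Measurable g) {C : ℝ} (hC : ∀ z, |g z| ≤ C) :
    ∫ z, g z ∂(weightedLaw μ P) =
      ∑ s, ∑ a, P s a * ∫ y, g (s, a, y) ∂(μ : Measure (TransKernel S A)) := by
  have hi : ∀ s a, Integrable g (ENNReal.ofReal (P s a) •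
      (Measure.dirac s).prod ((Measure.dirac a).prod (μ : Measure (TransKernel S A)))) :=
    fun s a => (Integrable.of_bound hg.aestronglyMeasurable C (Eventually.of_forall hC)).smul_measure
      ENNReal.ofReal_ne_top
  rw [weightedLaw, integral_finsetSum_measure
    fun s _ => integrable_finsetSum_measure.2 fun a _ => hi s a]
  refine Finset.sum_congr rfl fun s _ => ?_
  rw [integral_finsetSum_measure fun a _ => hi s a]
  refine Finset.sum_congr rfl fun a _ => ?_
  rw [integral_smul_measure, ENNReal.toReal_ofReal (hP s a), smul_eq_mul, Measure.dirac_prod,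
    Measure.dirac_prod, Measure.map_map (by fun_prop) (by fun_prop),
    integral_map (by fun_prop) hg.aestronglyMeasurable]
  rfl

/-- The probability that a stage moves to the state `s`. -/
def nextProb (s : S) (z : Stage S A) : ℝ := z.2.2 z.1 z.2.1 s

theorem measurable_nextProb (s : S) : Measurable (nextProb (A := A) s) := by
  refine measurable_from_prod_countable_right fun s' => ?_
  refine measurable_from_prod_countable_right fun a' => ?_
  have h2 : Measurable fun y : TransKernel S A => y s' a' := by fun_prop
  exact (measurable_pi_apply s).comp (measurable_subtype_coe.comp h2)

theorem abs_nextProb_le (s : S) (z : Stage S A) : |nextProb s z| ≤ 1 := by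
  rw [nextProb, abs_of_nonneg (stdSimplex.zero_le _ _)]
  exact stdSimplex.le_one _ _

/-- The probability that the policy chooses the action `a` in the state `s` at time `n`. -/
def policyProb (n : ℕ) (s : S) (a : A) (ω : ℕ → Stage S A) : ℝ :=
  π n (fun i => ((ω i).1, (ω i).2.1)) s a

theorem measurable_policyProb (n : ℕ) (s : S) (a : A) :
    Measurable (policyProb π n s a) := by
  have h1 : Measurable fun p : Fin n → S × A => π n p s a := measurable_of_finite _
  refine h1.comp (measurable_pi_lambda _ fun i => ?_)
  have h2 : Measurable fun z : S × A × TransKernel S A => (z.1, z.2.1) := by fun_prop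
  exact h2.comp (measurable_pi_apply _)

theorem policyProb_nonneg (n : ℕ) (s : S) (a : A) (ω : ℕ → Stage S A) :
    0 ≤ policyProb π n s a ω := stdSimplex.zero_le _ _

theorem policyProb_le_one (n : ℕ) (s : S) (a : A) (ω : ℕ → Stage S A) :
    policyProb π n s a ω ≤ 1 := stdSimplex.le_one _ _

theorem integrable_nextProb_mul_policyProb (n : ℕ) (s : S) (a : A) :
    Integrable (fun ω => nextProb s (ω n) * policyProb π (n + 1) s a ω) (trajLaw p₀ π μ) := by
  refine Integrable.of_bound (C := 1) (Measurable.aestronglyMeasurable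
    (((measurable_nextProb s).comp (measurable_pi_apply n)).mul
      (measurable_policyProb π (n + 1) s a))) (Eventually.of_forall fun ω => ?_)
  rw [norm_mul, Real.norm_eq_abs, Real.norm_eq_abs, abs_of_nonneg (policyProb_nonneg π _ s a ω)]
  exact mul_le_one₀ (abs_nextProb_le s _) (policyProb_nonneg π _ s a ω)
    (policyProb_le_one π _ s a ω)

/-- The probability of the state `s` and the action `a` at time `n`. -/
noncomputable def occupancy : ℕ → S → A → ℝ
  | 0 => fun s a => p₀ s * π 0 Fin.elim0 s a
  | n + 1 => fun s a =>
    ∫ ω, nextProb s (ω n) * policyProb π (n + 1) s a ω ∂(trajLaw p₀ π μ)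

theorem occupancy_nonneg (n : ℕ) (s : S) (a : A) : 0 ≤ occupancy p₀ π μ n s a := by
  cases n with
  | zero => exact mul_nonneg (stdSimplex.zero_le _ _) (stdSimplex.zero_le _ _)
  | succ n =>
    exact integral_nonneg fun ω => mul_nonneg (stdSimplex.zero_le _ _) (policyProb_nonneg π _ s a ω)

/-- Given the past, a stage has fresh kernel law `μ` and history-dependent weights on `(s, a)`.
Averaging over the past changes only the weights, so all history dependence is absorbed into
`occupancy`. -/
theorem trajLaw_map_eq_weightedLaw (n : ℕ) :
    (trajLaw p₀ π μ).map (fun ω => ω n) = weightedLaw μ (occupancy p₀ π μ n) := by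
  cases n with
  | zero => exact trajLaw_map_zero p₀ π μ
  | succ n =>
    rw [trajLaw_map_succ]
    ext B hB
    have hm : ∀ s a, Measurable fun ω => ENNReal.ofReal
        (nextProb s (ω n) * policyProb π (n + 1) s a ω) := fun s a =>
      (((measurable_nextProb s).comp (measurable_pi_apply n)).mul
        (measurable_policyProb π (n + 1) s a)).ennreal_ofReal
    rw [Measure.bind_apply hB (Kernel.aemeasurable _), lintegral_map
      (Kernel.measurable_coe _ hB) (by fun_prop)]
    have hk : ∀ ω : ℕ → Stage S A, stepKernel π μ n (Preorder.frestrictLe n ω) B =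
        ∑ s : S, ∑ a : A, ENNReal.ofReal (nextProb s (ω n) * policyProb π (n + 1) s a ω) *
          (Measure.dirac s).prod ((Measure.dirac a).prod (μ : Measure (TransKernel S A))) B := by
      intro ω
      change stageLaw _ _ _ B = _
      simp only [stageLaw, Measure.coe_finsetSum, Finset.sum_apply, Measure.smul_apply,
        smul_eq_mul]
      rfl
    simp_rw [hk]
    rw [lintegral_finsetSum _ fun s _ => Finset.measurable_sum _ fun a _ => (hm s a).mul_const _]
    simp only [weightedLaw, Measure.coe_finsetSum, Finset.sum_apply, Measure.smul_apply,
      smul_eq_mul]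
    refine Finset.sum_congr rfl fun s _ => ?_
    rw [lintegral_finsetSum _ fun a _ => (hm s a).mul_const _]
    refine Finset.sum_congr rfl fun a _ => ?_
    rw [lintegral_mul_const _ (hm s a), occupancy, ofReal_integral_eq_lintegral_ofReal
      (integrable_nextProb_mul_policyProb p₀ π μ n s a) (Eventually.of_forall fun ω =>
        mul_nonneg (stdSimplex.zero_le _ _) (policyProb_nonneg π _ s a ω))]

theorem integral_trajLaw_eq_sum (n : ℕ) {g : Stage S A → ℝ} (hg : Measurable g) {C : ℝ}
    (hC : ∀ z, |g z| ≤ C) :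
    ∫ ω, g (ω n) ∂(trajLaw p₀ π μ) = ∑ s, ∑ a, occupancy p₀ π μ n s a *
      ∫ y, g (s, a, y) ∂(μ : Measure (TransKernel S A)) := by
  rw [← integral_weightedLaw μ (occupancy_nonneg p₀ π μ n) hg hC,
    ← trajLaw_map_eq_weightedLaw,
    integral_map (measurable_pi_apply n).aemeasurable hg.aestronglyMeasurable]

/-- The mean transition probability from `s` to `s'` under the action `a`. -/
noncomputable def meanKernel (s : S) (a : A) (s' : S) : ℝ :=
  ∫ y, y s a s' ∂(μ : Measure (TransKernel S A))

theorem sum_occupancy_zero (s : S) : ∑ a, occupancy p₀ π μ 0 s a = p₀ s := by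
  simp only [occupancy]
  rw [← Finset.mul_sum, stdSimplex.sum_eq_one, mul_one]

theorem integral_nextProb_eq (n : ℕ) (s' : S) :
    ∫ ω, nextProb s' (ω n) ∂(trajLaw p₀ π μ) =
      ∑ s, ∑ a, occupancy p₀ π μ n s a * meanKernel μ s a s' :=
  integral_trajLaw_eq_sum p₀ π μ n (measurable_nextProb s') (abs_nextProb_le s')

/-- The policy's probabilities sum to one and disappear; independence of the kernel then replaces it
by its mean. -/
theorem sum_occupancy_succ (n : ℕ) (s' : S) : ∑ a, occupancy p₀ π μ (n + 1) s' a =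
    ∑ s, ∑ a, occupancy p₀ π μ n s a * meanKernel μ s a s' := by
  rw [← integral_nextProb_eq]
  simp only [occupancy]
  rw [← integral_finsetSum _ fun a _ => integrable_nextProb_mul_policyProb p₀ π μ n s' a]
  refine integral_congr_ae (Eventually.of_forall fun ω => ?_)
  simp only [policyProb]
  rw [← Finset.mul_sum, stdSimplex.sum_eq_one, mul_one]

/-- The action probability does not depend on the history, so it leaves the integral. -/
theorem occupancy_stationary (x : S → stdSimplex ℝ A) (n : ℕ) (s : S) (a : A) :
    occupancy p₀ (stationary x) μ n s a =
      (∑ a', occupancy p₀ (stationary x) μ n s a') * x s a := by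
  cases n with
  | zero => rw [sum_occupancy_zero]; rfl
  | succ n =>
    rw [sum_occupancy_succ, ← integral_nextProb_eq, occupancy, ← integral_mul_const]
    rfl

theorem sum_occupancy (n : ℕ) : ∑ s, ∑ a, occupancy p₀ π μ n s a = 1 := by
  have h := integral_trajLaw_eq_sum p₀ π μ n (g := fun _ => (1 : ℝ)) measurable_const (C := 1)
    (fun _ => by simp)
  simpa using h.symm

theorem abs_le_sum_abs (c : S → A → ℝ) (s : S) (a : A) : |c s a| ≤ ∑ s, ∑ a, |c s a| :=
  (Finset.single_le_sum (f := fun a => |c s a|) (fun _ _ => abs_nonneg _) (Finset.mem_univ a)).trans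
    (Finset.single_le_sum (f := fun s => ∑ a, |c s a|)
      (fun _ _ => Finset.sum_nonneg fun _ _ => abs_nonneg _) (Finset.mem_univ s))

theorem abs_sum_occupancy_mul_le (n : ℕ) {f : S → A → ℝ} {M : ℝ} (hf : ∀ s a, |f s a| ≤ M) :
    |∑ s, ∑ a, occupancy p₀ π μ n s a * f s a| ≤ M := by
  calc |∑ s, ∑ a, occupancy p₀ π μ n s a * f s a|
      ≤ ∑ s, ∑ a, occupancy p₀ π μ n s a * M := by
        refine (Finset.abs_sum_le_sum_abs _ _).trans (Finset.sum_le_sum fun s _ => ?_)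
        refine (Finset.abs_sum_le_sum_abs _ _).trans (Finset.sum_le_sum fun a _ => ?_)
        rw [abs_mul, abs_of_nonneg (occupancy_nonneg p₀ π μ n s a)]
        exact mul_le_mul_of_nonneg_left (hf s a) (occupancy_nonneg p₀ π μ n s a)
    _ = M := by
        simp only [← Finset.sum_mul]
        rw [sum_occupancy, one_mul]

variable (c : S → A → ℝ) {γ : ℝ}

theorem hasSum_discountedCost (hγ0 : 0 ≤ γ) (hγ1 : γ < 1) : HasSum
    (fun n => γ ^ n * ∑ s, ∑ a, occupancy p₀ π μ n s a * c s a) (discountedCost c γ p₀ π μ) := by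
  set M := ∑ s, ∑ a, |c s a|
  have hcm : Measurable fun z : Stage S A => c z.1 z.2.1 := by
    have h1 : Measurable fun q : S × A => c q.1 q.2 := measurable_of_finite _
    have h2 : Measurable fun z : S × A × TransKernel S A => (z.1, z.2.1) := by fun_prop
    exact h1.comp h2
  have hint : ∀ n, ∫ ω, γ ^ n * c (ω n).1 (ω n).2.1 ∂(trajLaw p₀ π μ) =
      γ ^ n * ∑ s, ∑ a, occupancy p₀ π μ n s a * c s a := fun n => by
    rw [integral_const_mul, integral_trajLaw_eq_sum p₀ π μ n hcm
      (fun z => abs_le_sum_abs c z.1 z.2.1)]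
    simp
  have hbound : ∀ n (ω : ℕ → Stage S A), ‖γ ^ n * c (ω n).1 (ω n).2.1‖ ≤ γ ^ n * M :=
      fun n ω => by
    rw [norm_mul, norm_pow, Real.norm_eq_abs, Real.norm_eq_abs, abs_of_nonneg hγ0]
    exact mul_le_mul_of_nonneg_left (abs_le_sum_abs c _ _) (pow_nonneg hγ0 n)
  have hF : ∀ n, Integrable (fun ω : ℕ → Stage S A => γ ^ n * c (ω n).1 (ω n).2.1)
      (trajLaw p₀ π μ) := fun n =>
    Integrable.of_bound ((hcm.comp (measurable_pi_apply n)).const_mul _).aestronglyMeasurable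
      (γ ^ n * M) (Eventually.of_forall (hbound n))
  have hS : Summable fun n => ∫ ω, ‖γ ^ n * c (ω n).1 (ω n).2.1‖ ∂(trajLaw p₀ π μ) := by
    refine Summable.of_nonneg_of_le (fun n => integral_nonneg fun ω => norm_nonneg _) (fun n => ?_)
      ((summable_geometric_of_lt_one hγ0 hγ1).mul_right M)
    refine (integral_mono (hF n).norm (integrable_const _) (hbound n)).trans ?_
    simp
  have h := hasSum_integral_of_summable_integral_norm hF hS
  simp_rw [hint] at h
  exact h

/-- The expected value of `w` at the state of time `n`. -/
noncomputable def stateValue (w : S → ℝ) (n : ℕ) : ℝ :=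
  ∑ s, (∑ a, occupancy p₀ π μ n s a) * w s

theorem stateValue_zero (w : S → ℝ) : stateValue p₀ π μ w 0 = ∑ s, p₀ s * w s := by
  simp only [stateValue, sum_occupancy_zero]

theorem abs_stateValue_le (w : S → ℝ) (n : ℕ) : |stateValue p₀ π μ w n| ≤ ∑ s, |w s| := by
  simp only [stateValue, Finset.sum_mul]
  exact abs_sum_occupancy_mul_le p₀ π μ n fun s _ =>
    Finset.single_le_sum (f := fun s => |w s|) (fun _ _ => abs_nonneg _) (Finset.mem_univ s)

theorem sum_occupancy_mul_add_stateValue (w : S → ℝ) (n : ℕ) :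
    ∑ s, ∑ a, occupancy p₀ π μ n s a * c s a + γ * stateValue p₀ π μ w (n + 1) =
      ∑ s, ∑ a, occupancy p₀ π μ n s a * (c s a + γ * ∑ s', meanKernel μ s a s' * w s') := by
  have h : stateValue p₀ π μ w (n + 1) =
      ∑ s, ∑ a, occupancy p₀ π μ n s a * ∑ s', meanKernel μ s a s' * w s' := by
    simp only [stateValue, sum_occupancy_succ, Finset.sum_mul, Finset.mul_sum]
    rw [Finset.sum_comm]
    refine Finset.sum_congr rfl fun s _ => ?_
    rw [Finset.sum_comm]
    exact Finset.sum_congr rfl fun a _ => Finset.sum_congr rfl fun s' _ => mul_assoc _ _ _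
  rw [h, Finset.mul_sum, ← Finset.sum_add_distrib]
  refine Finset.sum_congr rfl fun s _ => ?_
  rw [Finset.mul_sum, ← Finset.sum_add_distrib]
  exact Finset.sum_congr rfl fun a _ => by ring

/-- The hypothesis holds for each action separately, so it survives averaging against the
occupancies of an arbitrary policy. -/
theorem le_discountedCost (hγ0 : 0 ≤ γ) (hγ1 : γ < 1) {w : S → ℝ} {ε : ℝ}
    (h : ∀ s a, w s - ε ≤ c s a + γ * ∑ s', meanKernel μ s a s' * w s') :
    ∑ s, p₀ s * w s - ε / (1 - γ) ≤ discountedCost c γ p₀ π μ := by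
  rw [← stateValue_zero p₀ π μ w]
  refine le_of_forall_discounted_le hγ0 hγ1 (abs_stateValue_le p₀ π μ w)
    (hasSum_discountedCost p₀ π μ c hγ0 hγ1) fun n => ?_
  rw [sum_occupancy_mul_add_stateValue]
  have h1 : stateValue p₀ π μ w n - ε = ∑ s, ∑ a, occupancy p₀ π μ n s a * (w s - ε) := by
    simp only [mul_sub, Finset.sum_sub_distrib, ← Finset.sum_mul, sum_occupancy, one_mul]
    rfl
  rw [h1]
  exact Finset.sum_le_sum fun s _ => Finset.sum_le_sum fun a _ =>
    mul_le_mul_of_nonneg_left (h s a) (occupancy_nonneg p₀ π μ n s a)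

theorem sum_occupancy_stationary_mul (x : S → stdSimplex ℝ A) (n : ℕ) (f : S → A → ℝ) :
    ∑ s, ∑ a, occupancy p₀ (stationary x) μ n s a * f s a =
      ∑ s, (∑ a, occupancy p₀ (stationary x) μ n s a) * ∑ a, x s a * f s a := by
  refine Finset.sum_congr rfl fun s _ => ?_
  rw [Finset.mul_sum]
  refine Finset.sum_congr rfl fun a _ => ?_
  rw [occupancy_stationary, mul_assoc]

/-- Since occupancies factor through `x`, an inequality averaged over the actions suffices here. -/
theorem le_discountedCost_stationary (hγ0 : 0 ≤ γ) (hγ1 : γ < 1) (x : S → stdSimplex ℝ A)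
    {w : S → ℝ}
    (h : ∀ s, w s ≤ ∑ a, x s a * (c s a + γ * ∑ s', meanKernel μ s a s' * w s')) :
    ∑ s, p₀ s * w s ≤ discountedCost c γ p₀ (stationary x) μ := by
  rw [← stateValue_zero p₀ (stationary x) μ w]
  have h0 := le_of_forall_discounted_le (ε := 0) hγ0 hγ1
    (abs_stateValue_le p₀ (stationary x) μ w)
    (hasSum_discountedCost p₀ (stationary x) μ c hγ0 hγ1) fun n => ?_
  · simpa using h0
  rw [sum_occupancy_mul_add_stateValue, sum_occupancy_stationary_mul, sub_zero]
  exact Finset.sum_le_sum fun s _ => mul_le_mul_of_nonneg_left (h s)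
    (Finset.sum_nonneg fun a _ => occupancy_nonneg p₀ _ μ n s a)

theorem discountedCost_stationary_le (hγ0 : 0 ≤ γ) (hγ1 : γ < 1) (x : S → stdSimplex ℝ A)
    {w : S → ℝ}
    (h : ∀ s, ∑ a, x s a * (c s a + γ * ∑ s', meanKernel μ s a s' * w s') ≤ w s) :
    discountedCost c γ p₀ (stationary x) μ ≤ ∑ s, p₀ s * w s := by
  rw [← stateValue_zero p₀ (stationary x) μ w]
  -- The upper bound is the lower bound for the negated costs and values.
  have hC := (hasSum_discountedCost p₀ (stationary x) μ c hγ0 hγ1).neg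
  simp only [← mul_neg] at hC
  have h0 := le_of_forall_discounted_le (ε := 0) (W := fun n => -stateValue p₀ (stationary x) μ w n)
    hγ0 hγ1 (fun n => (abs_neg _).trans_le (abs_stateValue_le p₀ (stationary x) μ w n)) hC
    fun n => ?_
  · simp only [zero_div, sub_zero] at h0
    exact neg_le_neg_iff.1 h0
  rw [sub_zero, mul_neg, ← neg_add, neg_le_neg_iff, sum_occupancy_mul_add_stateValue,
    sum_occupancy_stationary_mul]
  exact Finset.sum_le_sum fun s _ => mul_le_mul_of_nonneg_left (h s)
    (Finset.sum_nonneg fun a _ => occupancy_nonneg p₀ _ μ n s a)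

theorem discountedCost_le (hγ0 : 0 ≤ γ) (hγ1 : γ < 1) :
    discountedCost c γ p₀ π μ ≤ (1 - γ)⁻¹ * ∑ s, ∑ a, |c s a| := by
  refine hasSum_le (fun n => ?_) (hasSum_discountedCost p₀ π μ c hγ0 hγ1)
    ((hasSum_geometric_of_lt_one hγ0 hγ1).mul_right _)
  exact mul_le_mul_of_nonneg_left ((le_abs_self _).trans
    (abs_sum_occupancy_mul_le p₀ π μ n (abs_le_sum_abs c))) (pow_nonneg hγ0 n)

theorem bddAbove_discountedCost_image (hγ0 : 0 ≤ γ) (hγ1 : γ < 1)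
    (D : Set (ProbabilityMeasure (TransKernel S A))) :
    BddAbove (discountedCost c γ p₀ π '' D) :=
  ⟨_, Set.forall_mem_image.2 fun μ _ => discountedCost_le p₀ π μ c hγ0 hγ1⟩

end Trajectory

/-! ### The robust Bellman operator and the minimax inequality -/

section Bellman

variable {S A : Type*} [Fintype S] [Fintype A]

/-- The properties of the ambiguity set of one state that the Bellman equation depends on: each
continuous function has a largest expectation, and mixtures stay in the set. -/
structure IsAdversary (D : Set (ProbabilityMeasure (StateKernel S A))) : Prop where
  exists_max : ∀ f : StateKernel S A → ℝ, Continuous f → ∃ m ∈ D, ∀ m' ∈ D,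
    ∫ y, f y ∂(m' : Measure (StateKernel S A)) ≤ ∫ y, f y ∂(m : Measure (StateKernel S A))
  exists_mix : ∀ m₁ ∈ D, ∀ m₂ ∈ D, ∀ a b : ℝ≥0∞, a + b = 1 → ∃ m ∈ D,
    (m : Measure (StateKernel S A)) =
      a • (m₁ : Measure (StateKernel S A)) + b • (m₂ : Measure (StateKernel S A))

theorem isAdversary_stateAmbiguity {d : StateKernel S A → StateKernel S A → ℝ} {N : ℕ} {θ : ℝ}
    (hd : IsKernelMetric d) (hθ : 0 ≤ θ) (hN : 0 < N) (yhat : Fin N → StateKernel S A) :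
    IsAdversary (stateAmbiguity d yhat θ) :=
  ⟨fun _ hf => exists_isMaxOn_stateAmbiguity hd hθ hN yhat hf,
    fun _ h₁ _ h₂ _ _ hab => exists_mem_stateAmbiguity_mix hθ h₁ h₂ hab⟩

theorem continuous_stateKernel_apply (a : A) (s' : S) :
    Continuous fun y : StateKernel S A => y a s' :=
  (continuous_apply s').comp (continuous_subtype_val.comp (continuous_apply a))

/-- The mean cost of the action `a` when the transition parameters have the law `m` and the value
of the next state is `v`. -/
noncomputable def meanCost (cs : A → ℝ) (γ : ℝ) (v : S → ℝ)
    (m : ProbabilityMeasure (StateKernel S A)) (a : A) : ℝ :=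
  cs a + γ * ∑ s', (∫ y, y a s' ∂(m : Measure (StateKernel S A))) * v s'

variable {cs : A → ℝ} {γ : ℝ} {v : S → ℝ} {D : Set (ProbabilityMeasure (StateKernel S A))}

theorem bellmanCost_eq_sum (x : A → ℝ) (m : ProbabilityMeasure (StateKernel S A)) :
    bellmanCost cs γ v x m = ∑ a, x a * meanCost cs γ v m a := by
  have hi : ∀ a s', Integrable (fun y : StateKernel S A => y a s')
      (m : Measure (StateKernel S A)) := fun a s' =>
    integrable_of_continuous (continuous_stateKernel_apply a s') _
  have hs : ∀ a, Integrable (fun y : StateKernel S A => ∑ s', y a s' * v s')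
      (m : Measure (StateKernel S A)) := fun a =>
    integrable_finsetSum _ fun s' _ => (hi a s').mul_const _
  have ht : ∀ a, Integrable (fun y : StateKernel S A => cs a + γ * ∑ s', y a s' * v s')
      (m : Measure (StateKernel S A)) := fun a =>
    (integrable_const _).add ((hs a).const_mul _)
  rw [bellmanCost, integral_finsetSum _ fun a _ => (ht a).const_mul _]
  refine Finset.sum_congr rfl fun a _ => ?_
  rw [integral_const_mul, integral_add (integrable_const _) ((hs a).const_mul _),
    integral_const_mul, integral_finsetSum _ fun s' _ => (hi a s').mul_const _]
  simp only [integral_mul_const, integral_const, probReal_univ, one_smul, meanCost]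

theorem continuous_bellmanIntegrand (x : A → ℝ) : Continuous fun y : StateKernel S A =>
    ∑ a, x a * (cs a + γ * ∑ s', y a s' * v s') := by
  refine continuous_finsetSum _ fun a _ => continuous_const.mul (continuous_const.add
    (continuous_const.mul (continuous_finsetSum _ fun s' _ => ?_)))
  exact (continuous_stateKernel_apply a s').mul continuous_const

theorem IsAdversary.isGreatest (hD : IsAdversary D) (x : A → ℝ) :
    IsGreatest (bellmanCost cs γ v x '' D) (bellmanObjective cs γ D v x) := by
  obtain ⟨m, hm, hmax⟩ := hD.exists_max _ (continuous_bellmanIntegrand (cs := cs) (γ := γ) (v := v) x)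
  have h : IsGreatest (bellmanCost cs γ v x '' D) (bellmanCost cs γ v x m) :=
    ⟨Set.mem_image_of_mem _ hm, Set.forall_mem_image.2 hmax⟩
  rwa [bellmanObjective, h.csSup_eq]

theorem IsAdversary.bellmanCost_le (hD : IsAdversary D) (x : A → ℝ)
    {m : ProbabilityMeasure (StateKernel S A)} (hm : m ∈ D) :
    bellmanCost cs γ v x m ≤ bellmanObjective cs γ D v x :=
  (hD.isGreatest x).2 (Set.mem_image_of_mem _ hm)

theorem IsAdversary.exists_bellmanCost_eq (hD : IsAdversary D) (cs : A → ℝ) (γ : ℝ) (v : S → ℝ)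
    (x : A → ℝ) : ∃ m ∈ D, bellmanCost cs γ v x m = bellmanObjective cs γ D v x :=
  (hD.isGreatest x).1

/-- The objective is a maximum of functions linear in `x`: the law that is worst at the convex
combination is admissible at both endpoints. -/
theorem IsAdversary.convexOn (hD : IsAdversary D) :
    ConvexOn ℝ Set.univ (bellmanObjective cs γ D v) := by
  refine ⟨convex_univ, fun x _ y _ a b ha hb _ => ?_⟩
  obtain ⟨m, hm, he⟩ := hD.exists_bellmanCost_eq cs γ v (a • x + b • y)
  have h : bellmanCost cs γ v (a • x + b • y) m =
      a * bellmanCost cs γ v x m + b * bellmanCost cs γ v y m := by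
    simp only [bellmanCost_eq_sum, Finset.mul_sum, ← Finset.sum_add_distrib]
    exact Finset.sum_congr rfl fun i _ => by
      simp only [Pi.add_apply, Pi.smul_apply, smul_eq_mul]; ring
  rw [← he, h]
  exact add_le_add (mul_le_mul_of_nonneg_left (hD.bellmanCost_le x hm) ha)
    (mul_le_mul_of_nonneg_left (hD.bellmanCost_le y hm) hb)

/-- The law that is worst at `x` gives a continuous minorant touching the objective at `x`. -/
theorem IsAdversary.lowerSemicontinuous (hD : IsAdversary D) :
    LowerSemicontinuous (bellmanObjective cs γ D v) := by
  intro x r hr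
  obtain ⟨m, hm, he⟩ := hD.exists_bellmanCost_eq cs γ v x
  have hc : Continuous fun x => bellmanCost cs γ v x m := by
    simp only [bellmanCost_eq_sum]
    fun_prop
  rw [← he] at hr
  filter_upwards [hc.continuousAt.eventually (lt_mem_nhds hr)] with y hy
  exact hy.trans_le (hD.bellmanCost_le y hm)

theorem IsAdversary.exists_isLeast [Nonempty A] (hD : IsAdversary D) (cs : A → ℝ) (γ : ℝ)
    (v : S → ℝ) : ∃ r, IsLeast (bellmanObjective cs γ D v '' stdSimplex ℝ A) r := by
  classical
  obtain ⟨x, hx, hmin⟩ := LowerSemicontinuousOn.exists_isMinOn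
    ⟨_, single_mem_stdSimplex ℝ (Classical.arbitrary A)⟩ (isCompact_stdSimplex ℝ A)
    ((hD.lowerSemicontinuous (cs := cs) (γ := γ) (v := v)).lowerSemicontinuousOn _)
  exact ⟨_, Set.mem_image_of_mem _ hx, Set.forall_mem_image.2 fun _ hy => hmin hy⟩

theorem integral_stateKernel_nonneg (m : ProbabilityMeasure (StateKernel S A)) (a : A) (s' : S) :
    0 ≤ ∫ y, y a s' ∂(m : Measure (StateKernel S A)) :=
  integral_nonneg fun _ => stdSimplex.zero_le _ _

theorem sum_integral_stateKernel (m : ProbabilityMeasure (StateKernel S A)) (a : A) :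
    ∑ s', ∫ y, y a s' ∂(m : Measure (StateKernel S A)) = 1 := by
  rw [← integral_finsetSum _ fun s' _ =>
    integrable_of_continuous (continuous_stateKernel_apply a s') _]
  simp

theorem meanCost_le_add_dist (hγ0 : 0 ≤ γ) (u v : S → ℝ)
    (m : ProbabilityMeasure (StateKernel S A)) (a : A) :
    meanCost cs γ u m a ≤ meanCost cs γ v m a + γ * dist u v := by
  rw [meanCost, meanCost, add_assoc, ← mul_add]
  refine add_le_add_right (mul_le_mul_of_nonneg_left ?_ hγ0) _
  calc ∑ s', (∫ y, y a s' ∂(m : Measure (StateKernel S A))) * u s'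
      ≤ ∑ s', (∫ y, y a s' ∂(m : Measure (StateKernel S A))) * (v s' + dist u v) := by
        refine Finset.sum_le_sum fun s' _ =>
          mul_le_mul_of_nonneg_left ?_ (integral_stateKernel_nonneg m a s')
        have h := (le_abs_self _).trans ((Real.dist_eq _ _).symm.trans_le (dist_le_pi_dist u v s'))
        linarith
    _ = _ := by
        simp only [mul_add, Finset.sum_add_distrib, ← Finset.sum_mul]
        rw [sum_integral_stateKernel, one_mul]

/-- Compare at the minimizer for `v` under its worst law for `u`. Mean transition rows are
probability vectors, so exchanging `u` and `v` costs at most `γ * dist u v`. -/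
theorem IsAdversary.isLeast_le_add_dist (hD : IsAdversary D) (hγ0 : 0 ≤ γ) {u v : S → ℝ} {r t : ℝ}
    (hr : IsLeast (bellmanObjective cs γ D u '' stdSimplex ℝ A) r)
    (ht : IsLeast (bellmanObjective cs γ D v '' stdSimplex ℝ A) t) : r ≤ t + γ * dist u v := by
  obtain ⟨x, hx, rfl⟩ := ht.1
  obtain ⟨m, hm, he⟩ := hD.exists_bellmanCost_eq cs γ u x
  refine (hr.2 (Set.mem_image_of_mem _ hx)).trans ?_
  rw [← he]
  refine le_trans ?_ (add_le_add_left (hD.bellmanCost_le x hm) _)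
  rw [bellmanCost_eq_sum, bellmanCost_eq_sum]
  calc ∑ a, x a * meanCost cs γ u m a
      ≤ ∑ a, x a * (meanCost cs γ v m a + γ * dist u v) := Finset.sum_le_sum fun a _ =>
        mul_le_mul_of_nonneg_left (meanCost_le_add_dist hγ0 u v m a) (hx.1 a)
    _ = _ := by
        simp only [mul_add, Finset.sum_add_distrib, ← Finset.sum_mul]
        rw [hx.2, one_mul]

/-- The Bellman equation has a solution. -/
theorem exists_bellman_fixedPoint [Nonempty A] (hγ0 : 0 ≤ γ) (hγ1 : γ < 1) (c : S → A → ℝ)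
    {Ds : S → Set (ProbabilityMeasure (StateKernel S A))} (hD : ∀ s, IsAdversary (Ds s)) :
    ∃ w : S → ℝ, ∀ s, IsLeast (bellmanObjective (c s) γ (Ds s) w '' stdSimplex ℝ A) (w s) := by
  -- `L` is the Bellman operator, a contraction for the supremum metric; Banach's theorem gives `w`.
  choose L hL using fun (u : S → ℝ) (s : S) => (hD s).exists_isLeast (c s) γ u
  have hc : ContractingWith ⟨γ, hγ0⟩ L := by
    refine ⟨hγ1, LipschitzWith.of_dist_le_mul fun u v => ?_⟩
    refine (dist_pi_le_iff (mul_nonneg hγ0 dist_nonneg)).2 fun s => ?_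
    rw [Real.dist_eq, abs_sub_le_iff]
    have h1 := (hD s).isLeast_le_add_dist hγ0 (hL u s) (hL v s)
    have h2 := (hD s).isLeast_le_add_dist hγ0 (hL v s) (hL u s)
    rw [dist_comm v u] at h2
    constructor <;> linarith
  refine ⟨hc.fixedPoint, fun s => ?_⟩
  have h := hL hc.fixedPoint s
  rwa [hc.fixedPoint_isFixedPt] at h

theorem IsAdversary.convex_image_meanCost (hD : IsAdversary D) :
    Convex ℝ (meanCost cs γ v '' D) := by
  rintro _ ⟨m₁, h₁, rfl⟩ _ ⟨m₂, h₂, rfl⟩ a b ha hb hab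
  obtain ⟨m, hm, he⟩ := hD.exists_mix m₁ h₁ m₂ h₂ (ENNReal.ofReal a) (ENNReal.ofReal b)
    (by rw [← ENNReal.ofReal_add ha hb, hab, ENNReal.ofReal_one])
  refine ⟨m, hm, funext fun i => ?_⟩
  have hi : ∀ s', ∫ y, y i s' ∂(m : Measure (StateKernel S A)) =
      a * ∫ y, y i s' ∂(m₁ : Measure (StateKernel S A)) +
      b * ∫ y, y i s' ∂(m₂ : Measure (StateKernel S A)) := fun s' => by
    have hc := continuous_stateKernel_apply (S := S) i s'
    rw [he, integral_add_measure
      ((integrable_of_continuous hc _).smul_measure ENNReal.ofReal_ne_top)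
      ((integrable_of_continuous hc _).smul_measure ENNReal.ofReal_ne_top),
      integral_smul_measure, integral_smul_measure, ENNReal.toReal_ofReal ha,
      ENNReal.toReal_ofReal hb, smul_eq_mul, smul_eq_mul]
  simp only [Pi.add_apply, Pi.smul_apply, smul_eq_mul, meanCost, hi, add_mul,
    Finset.sum_add_distrib, mul_assoc, ← Finset.mul_sum]
  linear_combination (-cs i) * hab

/-- A minimax inequality: a cost that no mixed action can beat in the worst case is almost a lower
bound for all actions under a single law. -/
theorem IsAdversary.exists_forall_sub_le_meanCost (hD : IsAdversary D) {r : ℝ}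
    (hr : ∀ x ∈ stdSimplex ℝ A, r ≤ bellmanObjective cs γ D v x) {ε : ℝ} (hε : 0 < ε) :
    ∃ m ∈ D, ∀ a, r - ε ≤ meanCost cs γ v m a := by
  classical
  by_contra hcon
  push Not at hcon
  -- If the claim fails, the convex set of mean cost vectors misses the open orthant above `r - ε`.
  -- Separate the two; the slack `ε` puts the constant vector `r` inside the orthant.
  obtain ⟨f, u, hfO, hfQ⟩ := geometric_hahn_banach_open
    (s := Set.univ.pi fun _ : A => Set.Ioi (r - ε)) (t := meanCost cs γ v '' D)
    (convex_pi fun _ _ => convex_Ioi _) (isOpen_set_pi Set.finite_univ fun _ _ => isOpen_Ioi)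
    hD.convex_image_meanCost (by
      rw [Set.disjoint_left]
      rintro _ hO ⟨m, hm, rfl⟩
      obtain ⟨a, ha⟩ := hcon m hm
      exact lt_asymm ha (hO a trivial))
  set k : A → ℝ := fun a => f (Pi.single a 1)
  have hf : ∀ q : A → ℝ, f q = ∑ a, q a * k a := fun q => by
    conv_lhs => rw [pi_eq_sum_univ' q]
    simp only [map_sum, map_smul, smul_eq_mul, k]
  -- The orthant is unbounded upwards. If `k a > 0`, the chosen multiple of the basis vector raises
  -- `f` from `b` to `b + |u - b| ≥ u`.
  have hk : ∀ a, k a ≤ 0 := fun a => by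
    by_contra! hpos
    set b := f fun _ => r
    have h1 := hfO ((fun _ => r) + (|u - b| / k a) • Pi.single a 1) fun a' _ => by
      have : 0 ≤ (|u - b| / k a) * (Pi.single a 1 : A → ℝ) a' :=
        mul_nonneg (by positivity) (by rw [Pi.single_apply]; split_ifs <;> norm_num)
      simp only [Set.mem_Ioi, Pi.add_apply, Pi.smul_apply, smul_eq_mul]
      linarith
    rw [map_add, map_smul, smul_eq_mul] at h1
    change b + |u - b| / k a * k a < u at h1
    rw [div_mul_cancel₀ _ hpos.ne'] at h1
    linarith [le_abs_self (u - b)]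
  have hr1 : r * ∑ a, k a < u := by
    have h1 := hfO (fun _ => r) fun a _ => by simp only [Set.mem_Ioi]; linarith
    rwa [hf, ← Finset.mul_sum] at h1
  -- A zero sum would force `f = 0`, hence both `0 < u` and `u ≤ 0`.
  have hK : ∑ a, k a < 0 := by
    refine lt_of_le_of_ne (Finset.sum_nonpos fun a _ => hk a) fun h0 => ?_
    have hk0 : ∀ a, k a = 0 := fun a =>
      (Finset.sum_eq_zero_iff_of_nonpos fun a _ => hk a).1 h0 a (Finset.mem_univ a)
    obtain ⟨m, hm, -⟩ := hD.exists_bellmanCost_eq cs γ v 0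
    have h1 := hfQ _ (Set.mem_image_of_mem _ hm)
    rw [hf] at h1
    simp only [hk0, mul_zero, Finset.sum_const_zero] at h1 hr1
    linarith
  -- The normalized coefficients form a mixed action. With `K = ∑ a, k a < 0` and its worst-case
  -- cost `G ≥ r`, one gets `u ≤ G * K ≤ r * K < u`.
  obtain ⟨m, hm, he⟩ := hD.exists_bellmanCost_eq cs γ v fun a => k a / ∑ a, k a
  have hx := hr (fun a => k a / ∑ a, k a)
    ⟨fun a => div_nonneg_of_nonpos (hk a) hK.le, by
      rw [← Finset.sum_div, div_self hK.ne]⟩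
  have h1 := hfQ _ (Set.mem_image_of_mem _ hm)
  have h2 : f (meanCost cs γ v m) = bellmanCost cs γ v (fun a => k a / ∑ a, k a) m * ∑ a, k a := by
    rw [hf, bellmanCost_eq_sum, Finset.sum_mul]
    refine Finset.sum_congr rfl fun a _ => ?_
    have := hK.ne
    field_simp
  rw [h2, he] at h1
  nlinarith

theorem eq_of_isLeast_of_isMinOn {X : Type*} {f : X → ℝ} {s : Set X} {r : ℝ} (h : IsLeast (f '' s) r)
    {x : X} (hx : x ∈ s) (hmin : IsMinOn f s x) : f x = r := by
  obtain ⟨⟨y, hy, rfl⟩, hle⟩ := h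
  exact le_antisymm (hmin hy) (hle (Set.mem_image_of_mem _ hx))

end Bellman

/-! ### Verification of optimality -/

section Optimality

variable {S A : Type*} [Fintype S] [MeasurableSpace S] [DiscreteMeasurableSpace S] [Fintype A]
  [MeasurableSpace A] [DiscreteMeasurableSpace A] {c : S → A → ℝ} {γ : ℝ}
  {Ds : S → Set (ProbabilityMeasure (StateKernel S A))} {w : S → ℝ}

/-- Only the marginal at `s` matters, so the adversary can optimize each state separately. -/
theorem meanKernel_pi (m : S → ProbabilityMeasure (StateKernel S A)) (s : S) (a : A) (s' : S) :
    meanKernel (ProbabilityMeasure.pi m) s a s' =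
      ∫ y, y a s' ∂(m s : Measure (StateKernel S A)) := by
  rw [meanKernel, ProbabilityMeasure.toMeasure_pi,
    ← (measurePreserving_eval (fun s => (m s : Measure (StateKernel S A))) s).map_eq,
    integral_map (measurable_pi_apply s).aemeasurable
      (continuous_stateKernel_apply a s').measurable.aestronglyMeasurable]

theorem cost_add_meanKernel_pi (m : S → ProbabilityMeasure (StateKernel S A)) (s : S) (a : A) :
    c s a + γ * ∑ s', meanKernel (ProbabilityMeasure.pi m) s a s' * w s' =
      meanCost (c s) γ w (m s) a := by
  simp only [meanKernel_pi, meanCost]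

theorem isGreatest_discountedCost_of_isMinOn (hγ0 : 0 ≤ γ) (hγ1 : γ < 1)
    (hD : ∀ s, IsAdversary (Ds s))
    (hw : ∀ s, IsLeast (bellmanObjective (c s) γ (Ds s) w '' stdSimplex ℝ A) (w s))
    {x : S → stdSimplex ℝ A}
    (hx : ∀ s, IsMinOn (bellmanObjective (c s) γ (Ds s) w) (stdSimplex ℝ A) (x s))
    (p₀ : stdSimplex ℝ S) :
    IsGreatest (discountedCost c γ p₀ (stationary x) '' rectangular Ds) (∑ s, p₀ s * w s) := by
  have hxw : ∀ s, bellmanObjective (c s) γ (Ds s) w (x s) = w s := fun s =>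
    eq_of_isLeast_of_isMinOn (hw s) (x s).2 (hx s)
  have hle : ∀ μ ∈ rectangular Ds,
      discountedCost c γ p₀ (stationary x) μ ≤ ∑ s, p₀ s * w s := by
    rintro _ ⟨m, hm, rfl⟩
    refine discountedCost_stationary_le p₀ _ c hγ0 hγ1 x fun s => ?_
    simp only [cost_add_meanKernel_pi]
    rw [← hxw s]
    exact (bellmanCost_eq_sum _ _).symm.trans_le ((hD s).bellmanCost_le _ (hm s))
  choose m hm he using fun s => (hD s).exists_bellmanCost_eq (c s) γ w (x s)
  have hmem : ProbabilityMeasure.pi m ∈ rectangular Ds := ⟨m, hm, rfl⟩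
  refine ⟨⟨_, hmem, le_antisymm (hle _ hmem) ?_⟩, Set.forall_mem_image.2 hle⟩
  refine le_discountedCost_stationary p₀ _ c hγ0 hγ1 x fun s => ?_
  simp only [cost_add_meanKernel_pi]
  rw [← hxw s, ← he s]
  exact (bellmanCost_eq_sum _ _).le

theorem le_worstCaseCost (hγ0 : 0 ≤ γ) (hγ1 : γ < 1) (hD : ∀ s, IsAdversary (Ds s))
    (hw : ∀ s, IsLeast (bellmanObjective (c s) γ (Ds s) w '' stdSimplex ℝ A) (w s))
    (p₀ : stdSimplex ℝ S) (π : Policy S A) :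
    ∑ s, p₀ s * w s ≤ worstCaseCost c γ (rectangular Ds) p₀ π := by
  have h1γ : 0 < 1 - γ := by linarith
  refine le_of_forall_pos_le_add fun ε hε => ?_
  -- The per-step slack `ε * (1 - γ)` accumulates to `ε` over the horizon.
  choose m hm he using fun s => (hD s).exists_forall_sub_le_meanCost
    (fun x hx => (hw s).2 (Set.mem_image_of_mem _ hx)) (mul_pos hε h1γ)
  have h := le_discountedCost p₀ π (ProbabilityMeasure.pi m) c hγ0 hγ1 (w := w)
    (ε := ε * (1 - γ)) fun s a => by rw [cost_add_meanKernel_pi]; exact he s a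
  rw [mul_div_cancel_right₀ _ h1γ.ne'] at h
  have h2 := le_csSup (bddAbove_discountedCost_image p₀ π c hγ0 hγ1 (rectangular Ds))
    (Set.mem_image_of_mem _ (show ProbabilityMeasure.pi m ∈ rectangular Ds from ⟨m, hm, rfl⟩))
  rw [worstCaseCost]
  linarith

theorem exists_forall_isMinOn
    (hw : ∀ s, IsLeast (bellmanObjective (c s) γ (Ds s) w '' stdSimplex ℝ A) (w s)) :
    ∃ x : S → stdSimplex ℝ A, ∀ s,
      IsMinOn (bellmanObjective (c s) γ (Ds s) w) (stdSimplex ℝ A) (x s) := by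
  choose x hx hxw using fun s => (hw s).1
  exact ⟨fun s => ⟨x s, hx s⟩, fun s y hy =>
    (hxw s).trans_le ((hw s).2 (Set.mem_image_of_mem _ hy))⟩

theorem valueVector_eq [DecidableEq S] (hγ0 : 0 ≤ γ) (hγ1 : γ < 1) (hD : ∀ s, IsAdversary (Ds s))
    (hw : ∀ s, IsLeast (bellmanObjective (c s) γ (Ds s) w '' stdSimplex ℝ A) (w s)) :
    valueVector c γ (rectangular Ds) = w := by
  obtain ⟨x, hx⟩ := exists_forall_isMinOn hw
  ext s
  have hs : ∑ s', stdSimplex.vertex (S := ℝ) s s' * w s' = w s := by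
    simp [Pi.single_apply]
  have hlow : ∀ y : S → stdSimplex ℝ A,
      w s ≤ worstCaseCost c γ (rectangular Ds) (stdSimplex.vertex s) (stationary y) := fun y => by
    have h := le_worstCaseCost hγ0 hγ1 hD hw (stdSimplex.vertex s) (stationary y)
    rwa [hs] at h
  have hval : worstCaseCost c γ (rectangular Ds) (stdSimplex.vertex s) (stationary x) = w s := by
    rw [worstCaseCost, (isGreatest_discountedCost_of_isMinOn hγ0 hγ1 hD hw hx _).csSup_eq, hs]
  have : Nonempty (S → stdSimplex ℝ A) := ⟨x⟩
  exact le_antisymm ((ciInf_le ⟨w s, Set.forall_mem_range.2 hlow⟩ x).trans_eq hval)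
    (le_ciInf hlow)

end Optimality

end DRMDP

/-! ### Bellman equation and optimal stationary policies -/

theorem mainTheorem5 {S A : Type*} [Fintype S] [DecidableEq S] [MeasurableSpace S]
    [DiscreteMeasurableSpace S] [Fintype A] [Nonempty A] [MeasurableSpace A]
    [DiscreteMeasurableSpace A]
    (c : S → A → ℝ) (γ : ℝ) (hγ0 : 0 ≤ γ) (hγ1 : γ < 1)
    (d : DRMDP.StateKernel S A → DRMDP.StateKernel S A → ℝ) (hd : DRMDP.IsKernelMetric d)
    {N : ℕ} (hN : 0 < N) (yhat : S → Fin N → DRMDP.StateKernel S A) (θ : ℝ) (hθ : 0 ≤ θ)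
    (Ds : S → Set (ProbabilityMeasure (DRMDP.StateKernel S A)))
    (hDs : Ds = fun s => DRMDP.stateAmbiguity d (yhat s) θ)
    (D : Set (ProbabilityMeasure (DRMDP.TransKernel S A))) (hD : D = DRMDP.rectangular Ds)
    (v : S → ℝ) (hv : v = DRMDP.valueVector c γ D)
    (g : S → (A → ℝ) → ℝ) (hg : g = fun s => DRMDP.bellmanObjective (c s) γ (Ds s) v) :
    -- the Bellman objectives are attained maxima and closed (proper, real-valued) convex functions
    (∀ s, (∀ x, IsGreatest (DRMDP.bellmanCost (c s) γ v x '' Ds s) (g s x)) ∧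
      ConvexOn ℝ Set.univ (g s) ∧ LowerSemicontinuous (g s)) ∧
    -- the Bellman equation, with an attained minimum over the simplex
    (∀ s, IsLeast (g s '' stdSimplex ℝ A) (v s)) ∧
    -- there is a stationary Markovian policy made of minimizers in the Bellman equation
    (∃ x : S → stdSimplex ℝ A, ∀ s, IsMinOn (g s) (stdSimplex ℝ A) (x s)) ∧
    -- and each such policy is optimal, for every initial distribution, among all policies
    (∀ x : S → stdSimplex ℝ A, (∀ s, IsMinOn (g s) (stdSimplex ℝ A) (x s)) →
      ∀ p₀ : stdSimplex ℝ S,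
        IsGreatest (DRMDP.discountedCost c γ p₀ (DRMDP.stationary x) '' D)
          (DRMDP.worstCaseCost c γ D p₀ (DRMDP.stationary x)) ∧
        ∀ π : DRMDP.Policy S A,
          DRMDP.worstCaseCost c γ D p₀ (DRMDP.stationary x) ≤ DRMDP.worstCaseCost c γ D p₀ π) := by
  have hA : ∀ s, DRMDP.IsAdversary (Ds s) := fun s => by
    rw [hDs]
    exact DRMDP.isAdversary_stateAmbiguity hd hθ hN (yhat s)
  obtain ⟨w, hw⟩ := DRMDP.exists_bellman_fixedPoint hγ0 hγ1 c hA
  -- `v` is defined through policies, not by an equation; identified with `w`, it inherits the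
  -- Bellman equation.
  have hvw : v = w := by rw [hv, hD, DRMDP.valueVector_eq hγ0 hγ1 hA hw]
  subst hvw hD hg
  refine ⟨fun s => ⟨fun x => (hA s).isGreatest x, (hA s).convexOn, (hA s).lowerSemicontinuous⟩,
    hw, DRMDP.exists_forall_isMinOn hw, fun x hx p₀ => ?_⟩
  have hgr := DRMDP.isGreatest_discountedCost_of_isMinOn hγ0 hγ1 hA hw hx p₀
  have hval : DRMDP.worstCaseCost c γ (DRMDP.rectangular Ds) p₀ (DRMDP.stationary x) =
      ∑ s, p₀ s * v s := hgr.csSup_eq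
  rw [hval]
  exact ⟨hgr, DRMDP.le_worstCaseCost hγ0 hγ1 hA hw p₀⟩
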